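/- For a list $\sigma=(\lambda_1,\dots,\lambda_5)$ of real numbers let $e_n(\sigma)=\sum_{1\le j_1<\dots<j_n\le 5}\lambda_{j_1}\cdots\lambda_{j_n}$ and $$r(\sigma)=e_3(\sigma)+e_1(\sigma)\left(\lambda_2^2+\lambda_5^2\right).$$ Assume that $$\sum_{j=1}^5\lambda_j\ge 0,\qquad \lambda_1\ge\lambda_2\ge\lambda_3\ge\lambda_4\ge\lambda_5>-\lambda_1,\qquad \lambda_3>e_1(\sigma),\qquad r(\sigma)\ge 0 .$$ For $s>0$ and $i\in\{2,3,4,5\}$ let $\sigma_i^{-s}$ be the list obtained from $\sigma$ by replacing $\lambda_1$ by $\lambda_1+s$ and $\lambda_i$ by $\lambda_i-s$. Then, for every real $s>0$ and every $i\in\{2,3,4,5\}$, the list $\sigma_i^{-s}$ is realizable by a $5\times5$ symmetric nonnegative matrix, i.e. there is a real symmetric $5\times 5$ matrix with nonnegative entries whose eigenvalues, counted with multiplicity, are the entries of $\sigma_i^{-s}$. -/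

import Mathlib

/-- The elementary symmetric sum `e_n(σ)` of a list of five real numbers.
A list `(λ₁, …, λ₅)` is a function `σ : Fin 5 → ℝ`, with `λ_j = σ (j - 1)`. -/
def elemSymm (n : ℕ) (σ : Fin 5 → ℝ) : ℝ :=
  ∑ t ∈ Finset.powersetCard n (Finset.univ : Finset (Fin 5)), ∏ j ∈ t, σ j

/-- `r(σ) = e₃(σ) + e₁(σ) (λ₂² + λ₅²)`. -/
def patternR (σ : Fin 5 → ℝ) : ℝ :=
  elemSymm 3 σ + elemSymm 1 σ * (σ 1 ^ 2 + σ 4 ^ 2)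

/-- The conditions on `σ = (λ₁, …, λ₅)`: nonnegative sum, `λ₁ ≥ λ₂ ≥ … ≥ λ₅ > -λ₁`,
`λ₃ > e₁(σ)` and `r(σ) ≥ 0`. -/
structure PatternConditions (σ : Fin 5 → ℝ) : Prop where
  sum_nonneg : 0 ≤ ∑ j, σ j
  antitone : Antitone σ
  neg_first_lt_last : -σ 0 < σ 4
  elemSymm_one_lt : elemSymm 1 σ < σ 2
  patternR_nonneg : 0 ≤ patternR σ

/-- `σ` is realizable by an `n × n` symmetric nonnegative matrix: some real symmetric, entrywise
nonnegative matrix has the entries of `σ` as its eigenvalues, counted with multiplicity. -/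
def SymmRealizable {n : ℕ} (σ : Fin n → ℝ) : Prop :=
  ∃ A : Matrix (Fin n) (Fin n) ℝ, A.IsSymm ∧ (∀ j k, 0 ≤ A j k) ∧
    A.charpoly = ∏ j, (Polynomial.X - Polynomial.C (σ j))

/-- The perturbed list `σ_i^{-s}`: the first entry `λ₁` is replaced by `λ₁ + s` and the entry of
index `i` by its value minus `s` (used for `i ≠ 0`, that is, not the first entry). -/
def guoMinus (σ : Fin 5 → ℝ) (i : Fin 5) (s : ℝ) : Fin 5 → ℝ :=
  Function.update (Function.update σ 0 (σ 0 + s)) i (σ i - s)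

/-! A reflection-invariant matrix splits into an odd 2×2 and an even 3×3 block. Giving `λ₂`, `λ₅` to
the odd block and the other entries to the even one leaves one sign condition, which is exactly
`r(σ) ≥ 0` (`PatternIneqs.symmRealizable`). Each perturbation keeps the sum and does not decrease
`r`, so the conditions persist until the order breaks, where two entries swap roles, or until the
third entry falls to the sum, where `symmRealizable_of_third_le_sum` takes over. -/

open Polynomial in
theorem SymmRealizable.congr_prod {n : ℕ} {σ τ : Fin n → ℝ} (h : SymmRealizable σ)
    (hp : (∏ j, (X - C (σ j)) : ℝ[X]) = ∏ j, (X - C (τ j))) : SymmRealizable τ := by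
  obtain ⟨A, hA, hn, hc⟩ := h
  exact ⟨A, hA, hn, hc.trans hp⟩

/-- A loop of weight `d` at the first vertex, and edges invariant under the reflection which
exchanges the second vertex with the third and the fourth with the fifth. -/
def reflMatrix (d u α β γ δ : ℝ) : Matrix (Fin 5) (Fin 5) ℝ :=
  !![d, u, u, 0, 0;
     u, 0, α, γ, δ;
     u, α, 0, δ, γ;
     0, γ, δ, 0, β;
     0, δ, γ, β, 0]

theorem reflMatrix_isSymm (d u α β γ δ : ℝ) : (reflMatrix d u α β γ δ).IsSymm := by
  ext i j
  fin_cases i <;> fin_cases j <;> rfl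

theorem reflMatrix_nonneg {d u α β γ δ : ℝ} (hd : 0 ≤ d) (hu : 0 ≤ u) (hα : 0 ≤ α) (hβ : 0 ≤ β)
    (hγ : 0 ≤ γ) (hδ : 0 ≤ δ) (i j : Fin 5) : 0 ≤ reflMatrix d u α β γ δ i j := by
  fin_cases i <;> fin_cases j <;> simp [reflMatrix, *]

-- The factors come from the odd block `[-α, γ-δ; γ-δ, -β]` and the even block `[d, √2u, 0; √2u, α,
-- γ+δ; 0, γ+δ, β]`.
open Polynomial in
theorem reflMatrix_charpoly (d u α β γ δ : ℝ) :
    (reflMatrix d u α β γ δ).charpoly =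
      (X ^ 2 + C (α + β) * X + C (α * β - (γ - δ) ^ 2)) *
      (X ^ 3 - C (d + α + β) * X ^ 2
        + C (d * α + d * β + α * β - (γ + δ) ^ 2 - 2 * u ^ 2) * X
        - C (d * (α * β - (γ + δ) ^ 2) - 2 * u ^ 2 * β)) := by
  have h : (reflMatrix d u α β γ δ).charmatrix =
      !![X - C d, -C u, -C u, 0, 0;
        -C u, X, -C α, -C γ, -C δ;
        -C u, -C α, X, -C δ, -C γ;
        0, -C γ, -C δ, X, -C β;
        0, -C δ, -C γ, -C β, X] := by
    ext1 i j
    fin_cases i <;> fin_cases j <;> simp [reflMatrix]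
  rw [Matrix.charpoly, h]
  simp [Matrix.det_succ_row_zero, Fin.sum_univ_succ, Fin.succAbove, -map_add, -map_sub, -map_mul,
    -map_pow]
  simp only [map_add, map_sub, map_mul, map_pow, map_ofNat]
  ring

open Polynomial in
theorem symmRealizable_of_reflMatrix {d u α β γ δ l₁ l₂ l₃ l₄ l₅ : ℝ}
    (hd : 0 ≤ d) (hu : 0 ≤ u) (hα : 0 ≤ α) (hβ : 0 ≤ β) (hγ : 0 ≤ γ) (hδ : 0 ≤ δ)
    (h1 : α + β = -(l₂ + l₅)) (h2 : α * β - (γ - δ) ^ 2 = l₂ * l₅)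
    (h3 : d + α + β = l₁ + l₃ + l₄)
    (h4 : d * α + d * β + α * β - (γ + δ) ^ 2 - 2 * u ^ 2 = l₁ * l₃ + l₁ * l₄ + l₃ * l₄)
    (h5 : d * (α * β - (γ + δ) ^ 2) - 2 * u ^ 2 * β = l₁ * l₃ * l₄) :
    SymmRealizable ![l₁, l₂, l₃, l₄, l₅] := by
  refine ⟨_, reflMatrix_isSymm d u α β γ δ, reflMatrix_nonneg hd hu hα hβ hγ hδ, ?_⟩
  rw [reflMatrix_charpoly, h1, h2, h3, h4, h5]
  simp [Fin.prod_univ_succ]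
  ring

/-- Lists whose third entry is at most their sum. -/
theorem symmRealizable_of_third_le_sum {l p x a b d : ℝ} (hd : 0 ≤ d) (hsum : l + p + x = d + a + b)
    (hx : x ≤ d) (hp : d < p) (hpa : p ≤ a) (hpb : p ≤ b) :
    SymmRealizable ![l, -b, p, x, -a] := by
  have had : 0 < a - d := by linarith
  have hla : a ≤ l := by linarith
  have hF : 0 ≤ (l - d) * (p - d) * (d - x) / (a - d) / 2 := by
    have h1 : 0 ≤ l - d := by linarith
    have h2 : 0 ≤ p - d := by linarith
    have h3 : 0 ≤ d - x := by linarith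
    positivity
  have hG : 0 ≤ (l - a) * (a - p) * (a - x) / (a - d) / 4 := by
    have h1 : 0 ≤ l - a := by linarith
    have h2 : 0 ≤ a - p := by linarith
    have h3 : 0 ≤ a - x := by linarith
    positivity
  have hl : l = d + a + b - p - x := by linarith
  -- With `γ = δ` the odd block is `diag(-b, -a)`. Evaluating the even cubic at `d` and at `a`
  -- determines `u` and `γ`.
  refine symmRealizable_of_reflMatrix (u := √((l - d) * (p - d) * (d - x) / (a - d) / 2))
    (γ := √((l - a) * (a - p) * (a - x) / (a - d) / 4))
    (δ := √((l - a) * (a - p) * (a - x) / (a - d) / 4)) (α := b) (β := a)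
    hd (Real.sqrt_nonneg _) (by linarith) (by linarith) (Real.sqrt_nonneg _) (Real.sqrt_nonneg _)
    (by ring) (by ring) (by linarith) ?_ ?_
  all_goals
    rw [← two_mul, mul_pow, Real.sq_sqrt hF, Real.sq_sqrt hG]
    field_simp
    rw [hl]
    ring

/-- The inequalities satisfied by a list of five reals `(l₁, l₂, l₃, -a, -b)` of sum `d`
meeting the pattern conditions. -/
structure PatternIneqs (l₁ l₂ l₃ a b d : ℝ) : Prop where
  sum_eq : l₁ + l₂ + l₃ = d + a + b
  sum_nonneg : 0 ≤ d
  le_second : l₃ ≤ l₂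
  sum_lt : d < l₃
  le_fifth : a ≤ b
  fifth_lt : b < l₁
  nonneg : 0 ≤ (l₁ * l₂ * l₃ - (l₁ * l₂ + l₁ * l₃ + l₂ * l₃) * (a + b) + (l₁ + l₂ + l₃) * (a * b)) +
    d * (l₂ ^ 2 + b ^ 2)

namespace PatternIneqs

variable {l₁ l₂ l₃ a b d : ℝ}

theorem second_lt (h : PatternIneqs l₁ l₂ l₃ a b d) : l₂ < a := by
  linarith [h.sum_eq, h.sum_lt, h.fifth_lt]

theorem add_le_fifth (h : PatternIneqs l₁ l₂ l₃ a b d) : l₂ + l₃ ≤ b := by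
  have hl := h.second_lt
  obtain ⟨h1, h2, h3, h4, h5, h6, h7⟩ := h
  by_contra! hb
  have hl2 : 0 < l₂ := by linarith
  have hl3 : 0 < l₃ := by linarith
  -- This is `(b + l₂) * r ≥ 0`, with `d` eliminated.
  have key : l₂ * (l₁ + l₂) * (l₂ + l₃) * (a - l₂) ≤ (l₁ - b) * (a + b) * (b * (b - l₃)) := by
    have := mul_nonneg (show 0 ≤ b + l₂ by linarith) h7
    have hd : d = l₁ + l₂ + l₃ - a - b := by linarith
    subst hd
    linarith
  have hm : b * (b - l₃) ≤ l₂ * (l₂ + l₃) := by nlinarith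
  have h8 : (l₁ - b) * (a + b) * (b * (b - l₃)) ≤ (l₁ - b) * (a + b) * (l₂ * (l₂ + l₃)) :=
    mul_le_mul_of_nonneg_left hm (mul_nonneg (by linarith) (by linarith))
  have h9 : 0 < l₂ * (l₂ + l₃) * ((b + l₂) * (a - l₂ - (l₁ - b))) :=
    mul_pos (by positivity) (mul_pos (by linarith) (by linarith))
  linarith

theorem symmRealizable (h : PatternIneqs l₁ l₂ l₃ a b d) :
    SymmRealizable ![l₁, l₂, l₃, -a, -b] := by
  have hl := h.second_lt
  obtain ⟨h1, h2, h3, h4, h5, h6, h7⟩ := h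
  have hl2 : 0 < l₂ := by linarith
  have hl3 : 0 < l₃ := by linarith
  have hb : 0 < b := by linarith
  have ht : 0 < b - l₂ := by linarith
  -- With `δ = 0`, the even block's second symmetric function forces `2u² = F`, and its determinant
  -- then forces `β = N / F`.
  obtain ⟨F, hF⟩ : ∃ F, F = d * (b - l₂) - l₂ * b - l₁ * l₃ + a * (l₁ + l₃) := ⟨_, rfl⟩
  obtain ⟨N, hN⟩ : ∃ N, N = l₁ * l₃ * a - d * l₂ * b := ⟨_, rfl⟩
  have hN0 : 0 < N := by
    have e1 : d * l₂ * b ≤ l₃ * l₂ * b := by gcongr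
    have e2 : l₃ * l₂ * b < l₃ * a * l₁ := by
      have : 0 < a := by linarith
      exact mul_lt_mul'' (by gcongr) h6 (by positivity) (by positivity)
    linarith
  -- The difference of the two sides is `r`; this gives `α ≥ 0`.
  have hr : N ≤ (b - l₂) * F := by
    have hd : d = l₁ + l₂ + l₃ - a - b := by linarith
    subst hF hN hd
    linarith
  have hF0 : 0 < F := pos_of_mul_pos_right (hN0.trans_le hr) ht.le
  have hβ : 0 ≤ N / F := by positivity
  have hβt : 0 ≤ b - l₂ - N / F := by
    rw [sub_nonneg, div_le_iff₀ hF0]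
    exact hr
  have hG : 0 ≤ (b - l₂ - N / F) * (N / F) + l₂ * b := by positivity
  have hNF : F * (N / F) = N := by field_simp
  refine symmRealizable_of_reflMatrix (d := d) (u := √(F / 2)) (α := b - l₂ - N / F) (β := N / F)
    (γ := √((b - l₂ - N / F) * (N / F) + l₂ * b)) (δ := 0)
    h2 (Real.sqrt_nonneg _) hβt hβ (Real.sqrt_nonneg _) le_rfl
    (by ring) ?_ (by linarith) ?_ ?_
  · rw [sub_zero, Real.sq_sqrt hG]
    ring
  · rw [add_zero, Real.sq_sqrt hG, Real.sq_sqrt (by positivity), hF]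
    ring
  · rw [add_zero, Real.sq_sqrt hG, Real.sq_sqrt (by positivity)]
    linear_combination -hNF - hN

/-- `add_le_fifth` gives `l₁ - l₂ - d = (a - l₂) + (b - l₂ - l₃) ≥ 0`, so `r` does not decrease. -/
theorem sub_second (h : PatternIneqs l₁ l₂ l₃ a b d) {s : ℝ} (hs : 0 ≤ s) (hle : l₃ ≤ l₂ - s) :
    PatternIneqs (l₁ + s) (l₂ - s) l₃ a b d := by
  have hl := h.second_lt
  have hb := h.add_le_fifth
  obtain ⟨h1, h2, h3, h4, h5, h6, h7⟩ := h
  refine ⟨by linarith, h2, hle, h4, h5, by linarith, ?_⟩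
  have e1 : 0 ≤ s * ((l₁ + l₂) * (l₁ - l₂ - d)) :=
    mul_nonneg hs (mul_nonneg (by linarith) (by linarith))
  have e2 : 0 ≤ s ^ 2 * (l₁ + l₂) := mul_nonneg (sq_nonneg s) (by linarith)
  have hd : d = l₁ + l₂ + l₃ - a - b := by linarith
  subst hd
  linarith

theorem sub_third (h : PatternIneqs l₁ l₂ l₃ a b d) {s : ℝ} (hs : 0 ≤ s) (hlt : d < l₃ - s) :
    PatternIneqs (l₁ + s) l₂ (l₃ - s) a b d := by
  have hl := h.second_lt
  obtain ⟨h1, h2, h3, h4, h5, h6, h7⟩ := h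
  refine ⟨by linarith, h2, by linarith, hlt, h5, by linarith, ?_⟩
  have e1 : 0 ≤ (a + b - l₂) * (s * (l₁ - l₃) + s ^ 2) :=
    mul_nonneg (by linarith) (add_nonneg (mul_nonneg hs (by linarith)) (sq_nonneg s))
  linarith

theorem sub_fourth (h : PatternIneqs l₁ l₂ l₃ a b d) {s : ℝ} (hs : 0 ≤ s) (hle : a + s ≤ b) :
    PatternIneqs (l₁ + s) l₂ l₃ (a + s) b d := by
  have hl := h.second_lt
  have hb := h.add_le_fifth
  obtain ⟨h1, h2, h3, h4, h5, h6, h7⟩ := h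
  refine ⟨by linarith, h2, h3, h4, hle, by linarith, ?_⟩
  have e1 : 0 ≤ (b - l₂ - l₃) * (s * (l₁ + a) + s ^ 2) :=
    mul_nonneg (by linarith) (add_nonneg (mul_nonneg hs (by linarith)) (sq_nonneg s))
  linarith

theorem sub_fifth (h : PatternIneqs l₁ l₂ l₃ a b d) {s : ℝ} (hs : 0 ≤ s) :
    PatternIneqs (l₁ + s) l₂ l₃ a (b + s) d := by
  have hl := h.second_lt
  obtain ⟨h1, h2, h3, h4, h5, h6, h7⟩ := h
  refine ⟨by linarith, h2, h3, h4, by linarith, by linarith, ?_⟩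
  have e1 : 0 ≤ s * ((l₁ - b) * (l₁ + b - d)) :=
    mul_nonneg hs (mul_nonneg (by linarith) (by linarith))
  have e2 : 0 ≤ s ^ 2 * (l₁ - b) := mul_nonneg (sq_nonneg s) (by linarith)
  have hd : d = l₁ + l₂ + l₃ - a - b := by linarith
  subst hd
  linarith

theorem symmRealizable_sub_third (h : PatternIneqs l₁ l₂ l₃ a b d) {s : ℝ} (hs : 0 ≤ s) :
    SymmRealizable ![l₁ + s, l₂, l₃ - s, -a, -b] := by
  rcases lt_or_ge d (l₃ - s) with hlt | hle
  · exact (h.sub_third hs hlt).symmRealizable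
  · have hl := h.second_lt
    obtain ⟨h1, h2, h3, h4, h5, h6, -⟩ := h
    refine (symmRealizable_of_third_le_sum (l := l₁ + s) (p := l₂) (x := l₃ - s) (a := a) (b := b)
      h2 (by linarith) hle (by linarith) hl.le (by linarith)).congr_prod ?_
    simp [Fin.prod_univ_succ, -mul_eq_mul_left_iff, -mul_eq_mul_right_iff]
    ring

theorem symmRealizable_sub_second (h : PatternIneqs l₁ l₂ l₃ a b d) {s : ℝ} (hs : 0 ≤ s) :
    SymmRealizable ![l₁ + s, l₂ - s, l₃, -a, -b] := by
  rcases le_total l₃ (l₂ - s) with hle | hle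
  · exact (h.sub_second hs hle).symmRealizable
  -- Once the second entry reaches `l₃`, the two swap roles and the rest of `s` comes off the third.
  · refine ((h.sub_second (s := l₂ - l₃) (by linarith [h.le_second])
      (by linarith)).symmRealizable_sub_third (s := s - (l₂ - l₃)) (by linarith)).congr_prod ?_
    simp [Fin.prod_univ_succ, -mul_eq_mul_left_iff, -mul_eq_mul_right_iff]
    ring

theorem symmRealizable_sub_fourth (h : PatternIneqs l₁ l₂ l₃ a b d) {s : ℝ} (hs : 0 ≤ s) :
    SymmRealizable ![l₁ + s, l₂, l₃, -a - s, -b] := by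
  rcases le_total (a + s) b with hle | hle
  · have := (h.sub_fourth hs hle).symmRealizable
    rwa [neg_add'] at this
  · refine ((h.sub_fourth (s := b - a) (by linarith [h.le_fifth])
      (by linarith)).sub_fifth (s := s - (b - a)) (by linarith)).symmRealizable.congr_prod ?_
    simp [Fin.prod_univ_succ, -mul_eq_mul_left_iff, -mul_eq_mul_right_iff]
    ring

theorem symmRealizable_sub_fifth (h : PatternIneqs l₁ l₂ l₃ a b d) {s : ℝ} (hs : 0 ≤ s) :
    SymmRealizable ![l₁ + s, l₂, l₃, -a, -b - s] := by
  have := (h.sub_fifth hs).symmRealizable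
  rwa [neg_add'] at this

end PatternIneqs

theorem elemSymm_one (σ : Fin 5 → ℝ) : elemSymm 1 σ = ∑ j, σ j := by
  simp [elemSymm, Finset.powersetCard_one]

theorem elemSymm_three (σ : Fin 5 → ℝ) :
    elemSymm 3 σ = σ 0 * σ 1 * σ 2 + (σ 0 * σ 1 + σ 0 * σ 2 + σ 1 * σ 2) * (σ 3 + σ 4) +
      (σ 0 + σ 1 + σ 2) * (σ 3 * σ 4) := by
  have h : Finset.powersetCard 3 (Finset.univ : Finset (Fin 5)) =
      {{0, 1, 2}, {0, 1, 3}, {0, 1, 4}, {0, 2, 3}, {0, 2, 4}, {0, 3, 4}, {1, 2, 3}, {1, 2, 4},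
        {1, 3, 4}, {2, 3, 4}} := by decide
  rw [elemSymm, h]
  repeat rw [Finset.sum_insert (by decide)]
  simp
  ring

theorem PatternConditions.patternIneqs {σ : Fin 5 → ℝ} (h : PatternConditions σ) :
    PatternIneqs (σ 0) (σ 1) (σ 2) (-σ 3) (-σ 4) (∑ j, σ j) := by
  obtain ⟨h1, h2, h3, h4, h5⟩ := h
  rw [elemSymm_one] at h4
  rw [patternR, elemSymm_one, elemSymm_three] at h5
  refine ⟨?_, h1, h2 (by decide), h4, neg_le_neg (h2 (by decide)), by linarith, by linarith⟩
  rw [Fin.sum_univ_five]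
  ring

theorem mainTheorem3 (σ : Fin 5 → ℝ) (hσ : PatternConditions σ)
    (s : ℝ) (hs : 0 < s) (i : Fin 5) (hi : i ≠ 0) :
    SymmRealizable (guoMinus σ i s) := by
  have h := hσ.patternIneqs
  have h₂ := h.symmRealizable_sub_second hs.le
  have h₃ := h.symmRealizable_sub_third hs.le
  have h₄ := h.symmRealizable_sub_fourth hs.le
  have h₅ := h.symmRealizable_sub_fifth hs.le
  simp only [neg_neg] at h₂ h₃ h₄ h₅
  fin_cases i
  · exact absurd rfl hi
  · convert h₂ using 1
    ext j
    fin_cases j <;> simp [guoMinus]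
  · convert h₃ using 1
    ext j
    fin_cases j <;> simp [guoMinus]
  · convert h₄ using 1
    ext j
    fin_cases j <;> simp [guoMinus]
  · convert h₅ using 1
    ext j
    fin_cases j <;> simp [guoMinus]
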